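/- Let $d\ge 0$ be an integer and let $A\subseteq[0,\infty)$ be arbitrary. Let $E$ be the set of (undirected) nearest neighbour edges of the lattice $\mathbb{Z}^d$, and let $\Omega=A^{E}$ be the space of configurations, equipped with the product topology, where $A$ carries the subspace topology of $[0,\infty)$. In a configuration $\omega\in\Omega$, the passage time $\tau_\omega(\Gamma)=\sum_{e\in\Gamma}\omega(e)$ of a finite lattice path $\Gamma$ is the sum of the values of its consecutive edges. For $x,y\in\mathbb{R}^d$ let $T_\omega(x,y)=\inf_\Gamma\tau_\omega(\Gamma)$, where $\Gamma$ runs over the finite lattice paths from $x'$ to $y'$, and $x',y'\in\mathbb{Z}^d$ are the lattice points with $x\in x'+[0,1)^d$ and $y\in y'+[0,1)^d$. Put $B_\omega(t)=\{x\in\mathbb{R}^d: T_\omega(0,x)\le t\}$. For $r\in[0,\infty]$ let $D_r$ be the closed $\ell_1$-ball of radius $r$ centred at $0$, so that $D_0=\{0\}$ and $D_\infty=\mathbb{R}^d$. Let $\mathcal{K}_A^d$ be the family of connected compact sets $K\subseteq\mathbb{R}^d$ with $$D_{1/\sup A}\subseteq K\subseteq D_{1/\inf A},$$ where $\sup$ and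 $\inf$ are taken in $[0,\infty]$, $1/\infty=0$ and $1/0=\infty$. Then there is a residual (comeagre) set $R\subseteq\Omega$ such that for every $\omega\in R$ and every convex set $K\in\mathcal{K}_A^d$ there exists a sequence $(t_n)$ of real numbers with $t_n\to+\infty$ and $$\frac{B_\omega(t_n)}{t_n}\to K$$ in the Hausdorff metric. -/

import Mathlib

open Filter Topology
open scoped NNReal ENNReal Pointwise

namespace FPP

/-- The space `ℝ^d` with the `ℓ¹` norm. Its topology (hence compactness, connectedness and Hausdorff
convergence towards a compact set) is the usual one. -/
abbrev Space (d : ℕ) : Type := PiLp 1 (fun _ : Fin d => ℝ)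

/-- The nearest neighbour graph on `ℤ^d`. -/
def lattice (d : ℕ) : SimpleGraph (Fin d → ℤ) where
  Adj x y := ∑ i, |x i - y i| = 1
  symm := ⟨fun x y h => by simpa only [abs_sub_comm] using h⟩
  loopless := ⟨fun x h => by simp at h⟩

/-- The set of configurations: one element of `A` on each (undirected) nearest neighbour edge.
As a function space it carries the product topology, `A` having the topology inherited from
`[0, ∞)`. -/
abbrev Config (d : ℕ) (A : Set ℝ≥0) : Type := (lattice d).edgeSet → A

/-- The passage time of a finite lattice path: the sum of the passage times of its consecutive
edges. -/
def pathTime {d : ℕ} {A : Set ℝ≥0} (ω : Config d A) :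
    {x y : Fin d → ℤ} → (lattice d).Walk x y → ℝ≥0
  | _, _, .nil => 0
  | _, _, .cons (u := u) (v := v) h p =>
      (ω ⟨s(u, v), (SimpleGraph.mem_edgeSet (lattice d)).2 h⟩ : ℝ≥0) + pathTime ω p

/-- The lattice point `x'` with `x ∈ x' + [0,1)^d`. -/
noncomputable def cell {d : ℕ} (x : Space d) : Fin d → ℤ := fun i => ⌊x i⌋

/-- The passage time between two points of `ℝ^d`: the infimum of the passage times of the lattice
paths from `x'` to `y'`. It is taken in `[0, ∞]`, but is finite as the lattice is connected. -/
noncomputable def passageTime {d : ℕ} {A : Set ℝ≥0} (ω : Config d A) (x y : Space d) : ℝ≥0∞ :=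
  ⨅ p : (lattice d).Walk (cell x) (cell y), (pathTime ω p : ℝ≥0∞)

/-- `B(t)`: the set of points of `ℝ^d` at passage time at most `t` from the origin. -/
noncomputable def ball {d : ℕ} {A : Set ℝ≥0} (ω : Config d A) (t : ℝ) : Set (Space d) :=
  {x | passageTime ω 0 x ≤ ENNReal.ofReal t}

/-- The closed `ℓ¹` ball of radius `r ∈ [0, ∞]` centred at the origin: `{0}` for `r = 0`,
all of `ℝ^d` for `r = ∞`. -/
def diamond (d : ℕ) (r : ℝ≥0∞) : Set (Space d) := Metric.closedEBall 0 r

/-- The connected compact sets `K` with `D_{1 / sup A} ⊆ K ⊆ D_{1 / inf A}`. The supremum, the infimum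
and the reciprocals are taken in `[0, ∞]`, so that `1 / ∞ = 0` and `1 / 0 = ∞`. -/
def shapes (d : ℕ) (A : Set ℝ≥0) : Set (Set (Space d)) :=
  {K | IsConnected K ∧ IsCompact K ∧
    diamond d (⨆ a ∈ A, (a : ℝ≥0∞))⁻¹ ⊆ K ∧ K ⊆ diamond d (⨅ a ∈ A, (a : ℝ≥0∞))⁻¹}

end FPP

/-!
By separability of the space of nonempty compact sets with the Hausdorff metric, it is enough to treat
countably many shapes, and for each convex shape `K`, each `ε > 0` and each `T` it is enough that the
configurations whose rescaled ball is `ε`-close to `K` at some time `t ≥ T` contain a dense open set.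
So, given a configuration prescribed on finitely many edges, one has to complete it to a configuration
whose ball at some large time `t` is near `t • K`, and remains so when the configuration is perturbed a
little on finitely many edges and arbitrarily on the others.

Up to a small error `K` is `{N ≤ 1}` for a positively homogeneous function `N` with `a ‖x‖ ≤ N x`
which is Lipschitz with a constant `b' < b`, where `a, b ∈ A` and `a` is close to `inf A`
(`exists_profile`; this is where convexity enters, through the gauge of a neighbourhood of `K`). The
exception is `A = {a}`, where `N x = a ‖x‖` and `b = a`; then the highway times below are exact, and no
gap between `b'` and `b` is needed. Choose finitely many unit vectors `u` that are dense up to a small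
error. Along each ray `ℝ₊ u` lay a *highway*: a lattice geodesic at bounded distance from the ray
(`exists_geodesic`), with edge times `a` and `b` mixed so that it is
traversed at the rate `N u` up to a bounded error (`exists_weights`). All remaining edges have time `b`.
Points on highways are reached at about time `N`, so the ball contains points near `t • p` for each `p`
with `N p ≤ 1`.

Conversely, the ball is not much larger than `{N ≤ t}`. Far from the origin the traversal times of the
highways, as a function on the union of the highways, are `b`-Lipschitz, since highways diverge linearly
and `b' < b` (`exists_le_mul_dist_of_geodesics`). Extend this function
to a `b`-Lipschitz function on `ℝ^d` and take the maximum with `N - C`, which is `b`-Lipschitz as well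
and does not exceed the traversal times on the highways. The result, cut off from below at a height that
makes it constant on the prescribed edges, changes by at most the edge time along every edge, hence
bounds passage times from below, and it is at least `N` up to a constant (`exists_config_of_highways`).
Truncating this potential above the level `t` leaves only finitely many edges on which it is not constant,
so the bound is stable in the product topology (`eventually_ball_le_of_potential`).
-/

namespace FPP

/-! ### Lattice points and passage times -/

/-- A lattice point, regarded as a point of `ℝ^d`. -/
def emb {d : ℕ} (z : Fin d → ℤ) : Space d := WithLp.toLp 1 fun i => (z i : ℝ)

lemma dist_emb {d : ℕ} (z w : Fin d → ℤ) :
    dist (emb z) (emb w) = ∑ i, |(z i : ℝ) - w i| := by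
  simp [PiLp.dist_eq_of_L1, emb, Real.dist_eq]

lemma norm_emb {d : ℕ} (z : Fin d → ℤ) : ‖emb z‖ = ∑ i, |(z i : ℝ)| := by
  simp [PiLp.norm_eq_of_L1, emb]

@[simp] lemma emb_zero {d : ℕ} : emb (0 : Fin d → ℤ) = 0 := by
  ext i; simp [emb]

@[simp] lemma cell_zero {d : ℕ} : cell (0 : Space d) = 0 := by
  ext i; simp [cell]

@[simp] lemma cell_emb {d : ℕ} (z : Fin d → ℤ) : cell (emb z) = z := by
  ext i; simp [cell, emb]

lemma dist_emb_cell_le {d : ℕ} (x : Space d) : dist x (emb (cell x)) ≤ d := by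
  rw [PiLp.dist_eq_of_L1]
  refine (Finset.sum_le_card_nsmul _ _ 1 fun i _ => ?_).trans (by simp)
  simp only [emb, cell, Real.dist_eq]
  rw [abs_le]
  constructor <;> linarith [Int.floor_le (x i), Int.lt_floor_add_one (x i)]

lemma dist_emb_of_adj {d : ℕ} {u v : Fin d → ℤ} (h : (lattice d).Adj u v) :
    dist (emb u) (emb v) = 1 := by
  have h' : ∑ i, |u i - v i| = 1 := h
  rw [dist_emb]
  exact_mod_cast h'

lemma finite_norm_emb_le {d : ℕ} (R : ℝ) : {z : Fin d → ℤ | ‖emb z‖ ≤ R}.Finite := by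
  refine (Set.finite_Icc (fun _ => -⌈R⌉) (fun _ => ⌈R⌉)).subset fun z hz => ?_
  have h (i) : |z i| ≤ ⌈R⌉ := by
    have h1 : |(z i : ℝ)| ≤ R := by
      refine le_trans ?_ hz
      rw [norm_emb]
      exact Finset.single_le_sum (f := fun i => |(z i : ℝ)|) (fun _ _ => abs_nonneg _)
        (Finset.mem_univ i)
    have h2 := h1.trans (Int.le_ceil R)
    exact_mod_cast h2
  exact ⟨fun i => (abs_le.1 (h i)).1, fun i => (abs_le.1 (h i)).2⟩

/-- The edge joining two adjacent lattice points. -/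
abbrev edge {d : ℕ} {u v : Fin d → ℤ} (h : (lattice d).Adj u v) : (lattice d).edgeSet :=
  ⟨s(u, v), (SimpleGraph.mem_edgeSet (lattice d)).2 h⟩

/-- A potential whose increment along each edge is at most the passage time of the edge bounds
passage times from below. -/
lemma sub_le_pathTime {d : ℕ} {A : Set ℝ≥0} (ω : Config d A) (φ : (Fin d → ℤ) → ℝ)
    (hφ : ∀ u v (h : (lattice d).Adj u v), φ v - φ u ≤ (ω (edge h) : ℝ≥0)) :
    ∀ {x y : Fin d → ℤ} (p : (lattice d).Walk x y), φ y - φ x ≤ pathTime ω p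
  | _, _, .nil => by simp [pathTime]
  | _, _, .cons (v := v) h p => by
      have h1 := hφ _ _ h
      have h2 := sub_le_pathTime ω φ hφ p
      simp only [pathTime, NNReal.coe_add]
      linarith

lemma sub_le_of_passageTime_le {d : ℕ} {A : Set ℝ≥0} (ω : Config d A) (φ : (Fin d → ℤ) → ℝ)
    (hφ : ∀ u v (h : (lattice d).Adj u v), φ v - φ u ≤ (ω (edge h) : ℝ≥0)) {t : ℝ} (ht : 0 ≤ t)
    {x : Space d} (hx : x ∈ ball ω t) : φ (cell x) - φ 0 ≤ t := by
  rw [← ENNReal.ofReal_le_ofReal_iff ht]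
  refine le_trans (le_iInf fun p => ?_) hx
  rw [ENNReal.ofReal_le_iff_le_toReal (by simp)]
  simpa using sub_le_pathTime ω φ hφ p

lemma pathTime_concat {d : ℕ} {A : Set ℝ≥0} (ω : Config d A) {w : Fin d → ℤ} :
    ∀ {x y : Fin d → ℤ} (p : (lattice d).Walk x y) (h : (lattice d).Adj y w),
      pathTime ω (p.concat h) = pathTime ω p + (ω (edge h) : ℝ≥0)
  | _, _, .nil, h => by simp [pathTime, SimpleGraph.Walk.concat]
  | _, _, .cons h' p, h => by
      simp only [SimpleGraph.Walk.concat_cons, pathTime, pathTime_concat ω p h, add_assoc]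

lemma exists_pathTime_eq_sum {d : ℕ} {A : Set ℝ≥0} (ω : Config d A) (γ : ℕ → Fin d → ℤ)
    (hγ : ∀ k, (lattice d).Adj (γ k) (γ (k + 1))) (k : ℕ) :
    ∃ p : (lattice d).Walk (γ 0) (γ k),
      pathTime ω p = ∑ j ∈ Finset.range k, (ω (edge (hγ j)) : ℝ≥0) := by
  induction k with
  | zero => exact ⟨.nil, by simp [pathTime]⟩
  | succ k ih =>
    obtain ⟨p, hp⟩ := ih
    exact ⟨p.concat (hγ k), by rw [pathTime_concat, hp, Finset.sum_range_succ]⟩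

lemma emb_mem_ball_of_sum_le {d : ℕ} {A : Set ℝ≥0} (ω : Config d A) (γ : ℕ → Fin d → ℤ)
    (h0 : γ 0 = 0) (hγ : ∀ k, (lattice d).Adj (γ k) (γ (k + 1))) {k : ℕ} {t : ℝ}
    (h : ∑ j ∈ Finset.range k, ((ω (edge (hγ j)) : ℝ≥0) : ℝ) ≤ t) : emb (γ k) ∈ ball ω t := by
  have key : ∃ p : (lattice d).Walk 0 (γ k), (pathTime ω p : ℝ) ≤ t := by
    obtain ⟨p, hp⟩ := exists_pathTime_eq_sum ω γ hγ k
    rw [← h0]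
    exact ⟨p, by rw [hp]; push_cast; exact h⟩
  change passageTime ω 0 (emb (γ k)) ≤ _
  rw [passageTime, cell_zero, cell_emb]
  obtain ⟨p, hp⟩ := key
  refine (iInf_le _ p).trans ?_
  simpa using ENNReal.ofReal_le_ofReal hp

/-! ### Highways -/

/-- A lattice geodesic staying at bounded distance from the ray through a given unit vector. -/
lemma exists_geodesic {d : ℕ} (u : Space d) (hu : ‖u‖ = 1) :
    ∃ γ : ℕ → Fin d → ℤ, γ 0 = 0 ∧ (∀ k, (lattice d).Adj (γ k) (γ (k + 1))) ∧
      (∀ k : ℕ, dist (emb (γ k)) ((k : ℝ) • u) ≤ 2 * d) ∧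
      ∀ k m : ℕ, |(k : ℝ) - m| ≤ dist (emb (γ k)) (emb (γ m)) := by
  have hsum : ∑ i, |u i| = 1 := by simpa [PiLp.norm_eq_of_L1] using hu
  -- The numbers of steps made in each coordinate: step in a coordinate that lags behind.
  obtain ⟨n, hn0, hn1, hn2, hn3⟩ : ∃ n : ℕ → Fin d → ℤ, n 0 = 0 ∧
      (∀ k, ∃ j, n (k + 1) = n k + Pi.single j 1) ∧ (∀ k, ∑ i, n k i = k) ∧
      ∀ k i, (n k i : ℝ) < k * |u i| + 1 := by
    have step (k : ℕ) (n : Fin d → ℤ) (hs : ∑ i, n i = (k : ℤ)) (hb : ∀ i, (n i : ℝ) < k * |u i| + 1) :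
        ∃ n' : Fin d → ℤ, (∃ j, n' = n + Pi.single j 1) ∧ (∑ i, n' i = (k + 1 : ℕ)) ∧
          ∀ i, (n' i : ℝ) < (k + 1 : ℕ) * |u i| + 1 := by
      obtain ⟨j, -, hj⟩ : ∃ j ∈ Finset.univ, (n j : ℝ) < (k + 1) * |u j| := by
        apply Finset.exists_lt_of_sum_lt
        rw [← Finset.mul_sum, hsum]
        have : (∑ i, (n i : ℝ)) = k := by exact_mod_cast hs
        linarith
      refine ⟨_, ⟨j, rfl⟩, by simp [Finset.sum_add_distrib, hs], fun i => ?_⟩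
      rcases eq_or_ne i j with rfl | hij
      · simpa using hj
      · have := hb i
        have := abs_nonneg (u i)
        simp [hij]
        linarith
    choose! f hf1 hf2 hf3 using step
    obtain ⟨n, hn0, hns⟩ : ∃ n : ℕ → Fin d → ℤ, n 0 = 0 ∧ ∀ k, n (k + 1) = f k (n k) :=
      ⟨fun k => Nat.rec 0 f k, rfl, fun _ => rfl⟩
    have inv (k : ℕ) : ∑ i, n k i = k ∧ ∀ i, (n k i : ℝ) < k * |u i| + 1 := by
      induction k with
      | zero => simp [hn0]
      | succ k ih => rw [hns]; exact ⟨hf2 k _ ih.1 ih.2, hf3 k _ ih.1 ih.2⟩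
    refine ⟨n, hn0, fun k => ?_, fun k => (inv k).1, fun k => (inv k).2⟩
    rw [hns]
    exact hf1 k _ (inv k).1 (inv k).2
  let σ : Fin d → ℤ := fun i => if 0 ≤ u i then 1 else -1
  have hσ (i) : |σ i| = 1 := by simp only [σ]; split_ifs <;> simp
  have hσ' (i) : |(σ i : ℝ)| = 1 := by exact_mod_cast hσ i
  have hσu (i) : u i = σ i * |u i| := by
    simp only [σ]
    split_ifs with h
    · simp [abs_of_nonneg h]
    · simp [abs_of_neg (not_le.1 h)]
  refine ⟨fun k i => σ i * n k i, by ext; simp [hn0], fun k => ?_, fun k => ?_, fun k m => ?_⟩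
  · change ∑ i, |σ i * n k i - σ i * n (k + 1) i| = 1
    obtain ⟨j, hj⟩ := hn1 k
    simp only [hj, ← mul_sub, abs_mul, hσ]
    rw [Finset.sum_eq_single j] <;> simp +contextual
  · rw [PiLp.dist_eq_of_L1]
    have h1 (i) : dist ((emb fun i => σ i * n k i) i) (((k : ℝ) • u) i)
        ≤ 2 - ((n k i : ℝ) - k * |u i|) := by
      have : (emb fun i => σ i * n k i) i - ((k : ℝ) • u) i = σ i * (n k i - k * |u i|) := by
        simp only [emb, PiLp.smul_apply, smul_eq_mul]
        rw [hσu i, abs_mul, abs_abs, hσ']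
        push_cast
        ring
      rw [Real.dist_eq, this, abs_mul, hσ', one_mul, abs_le]
      constructor <;> linarith [hn3 k i]
    refine (Finset.sum_le_sum fun i _ => h1 i).trans ?_
    have : (∑ i, (n k i : ℝ)) = k := by exact_mod_cast hn2 k
    rw [Finset.sum_sub_distrib, Finset.sum_sub_distrib, ← Finset.mul_sum, this, hsum]
    simp [mul_comm]
  · rw [dist_emb]
    have h1 (k : ℕ) : (∑ i, (n k i : ℝ)) = k := by exact_mod_cast hn2 k
    have : (k : ℝ) - m = ∑ i, ((n k i : ℝ) - n m i) := by
      rw [Finset.sum_sub_distrib, h1, h1]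
    rw [this]
    refine (Finset.abs_sum_le_sum_abs _ _).trans (Finset.sum_le_sum fun i _ => ?_)
    push_cast
    rw [← mul_sub, abs_mul, hσ', one_mul]

/-- A sequence with increments `a` or `b` growing at a prescribed rate between `a` and `b`. -/
lemma exists_weights {a b ρ : ℝ} (ha : a ≤ ρ) (hb : ρ ≤ b) :
    ∃ S : ℕ → ℝ, S 0 = 0 ∧ (∀ k, S (k + 1) - S k = a ∨ S (k + 1) - S k = b) ∧
      ∀ k : ℕ, S k ≤ ρ * k ∧ ρ * k - (b - a) ≤ S k := by
  let S : ℕ → ℝ := fun k =>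
    Nat.rec 0 (fun k s => s + if s + b ≤ ρ * (k + 1) then b else a) k
  have hS (k : ℕ) : S (k + 1) = S k + if S k + b ≤ ρ * (k + 1) then b else a := rfl
  refine ⟨S, rfl, fun k => ?_, fun k => ?_⟩
  · rw [hS]; split_ifs <;> simp
  · induction k with
    | zero => simp [S]; linarith
    | succ k ih =>
      rw [hS]
      push_cast
      split_ifs with h
      · constructor <;> linarith
      · constructor <;> linarith

/-! ### A configuration with prescribed highways -/

lemma exists_lipschitzWith_extension {X ι : Type*} [MetricSpace X] {K : ℝ≥0} (v : ι → X)
    (S : ι → ℝ) (h : ∀ i j, S i - S j ≤ K * dist (v i) (v j)) :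
    ∃ g : X → ℝ, LipschitzWith K g ∧ ∀ i, g (v i) = S i := by
  classical
  let f : X → ℝ := fun x => if hx : ∃ i, v i = x then S hx.choose else 0
  have hf (i) : f (v i) = S i := by
    have hx : ∃ j, v j = v i := ⟨i, rfl⟩
    have h1 := h hx.choose i
    have h2 := h i hx.choose
    simp only [hx.choose_spec, dist_self, mul_zero] at h1 h2
    simp only [f, dif_pos hx]
    linarith
  obtain ⟨g, hg, hgf⟩ := LipschitzOnWith.extend_real (f := f) (s := Set.range v) (K := K) <| by
    refine LipschitzOnWith.of_le_add_mul K ?_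
    rintro _ ⟨i, rfl⟩ _ ⟨j, rfl⟩
    rw [hf, hf]
    linarith [h i j]
  exact ⟨g, hg, fun i => by rw [← hgf ⟨i, rfl⟩, hf]⟩

lemma exists_bound_on_edges {d : ℕ} (F : Finset (lattice d).edgeSet) (f : (Fin d → ℤ) → ℝ) :
    ∃ M : ℝ, ∀ e ∈ F, ∀ u ∈ e.1, f u ≤ M := by
  have h (e : (lattice d).edgeSet) : ∃ M : ℝ, ∀ u ∈ e.1, f u ≤ M := by
    obtain ⟨e, -⟩ := e
    induction e with
    | h x y =>
      refine ⟨max (f x) (f y), fun u hu => ?_⟩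
      rcases Sym2.mem_iff.1 hu with rfl | rfl <;> simp
  choose M hM using h
  obtain ⟨B, hB⟩ := (F.finite_toSet.image M).bddAbove
  exact ⟨B, fun e he u hu => (hM e u hu).trans (hB ⟨e, he, rfl⟩)⟩

/-- Given lattice paths `γ i` with prescribed times `S i` growing by `a` or `b` at each step, and
consistent with the maximal speed `1 / b` off the paths, there is a configuration, prescribed on
finitely many edges, in which the path `γ i` is traversed in time `S i` up to a bounded error and in
which a potential, hence every passage time from the origin, exceeds `N` up to a bounded error. -/
lemma exists_config_of_highways {d : ℕ} {A : Set ℝ≥0} {a b : ℝ≥0} (ha : a ∈ A) (hb : b ∈ A)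
    (ω₀ : Config d A) (F : Finset (lattice d).edgeSet) {ι : Type*} [Finite ι]
    (γ : ι → ℕ → Fin d → ℤ) (hγ : ∀ i k, (lattice d).Adj (γ i k) (γ i (k + 1)))
    (hesc : ∀ i (k : ℕ), (k : ℝ) ≤ ‖emb (γ i k)‖) (S : ι → ℕ → ℝ) (hS0 : ∀ i, S i 0 = 0)
    (hS : ∀ i k, S i (k + 1) - S i k = a ∨ S i (k + 1) - S i k = b) (k₀ : ℕ)
    (hlip : ∀ i j k m, k₀ ≤ k → k₀ ≤ m →
      S i k - S j m ≤ b * dist (emb (γ i k)) (emb (γ j m)))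
    {N : Space d → ℝ} (hN : LipschitzWith b N) {C : ℝ}
    (hNS : ∀ i k, N (emb (γ i k)) - C ≤ S i k) :
    ∃ ω : Config d A, (∀ e ∈ F, ω e = ω₀ e) ∧ ∃ C' : ℝ,
      (∀ i k, ∑ j ∈ Finset.range k, ((ω (edge (hγ i j)) : ℝ≥0) : ℝ) ≤ S i k + C') ∧
      ∃ φ : (Fin d → ℤ) → ℝ, φ 0 = 0 ∧
        (∀ u v (h : (lattice d).Adj u v), φ v - φ u ≤ (ω (edge h) : ℝ≥0)) ∧
        ∀ z, N (emb z) - C' ≤ φ z := by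
  classical
  have hmono (i) : Monotone (S i) := monotone_nat_of_le_succ fun k => by
    rcases hS i k with h | h <;> linarith [a.coe_nonneg, b.coe_nonneg]
  -- Beyond `k₁` the paths avoid the edges on which the configuration is prescribed.
  obtain ⟨M₁, hM₁⟩ := exists_bound_on_edges F fun u => ‖emb u‖
  obtain ⟨k₁, hk₁⟩ : ∃ k₁ : ℕ, k₀ ≤ k₁ ∧ M₁ < k₁ := by
    obtain ⟨n, hn⟩ := exists_nat_gt M₁
    exact ⟨max k₀ n, le_max_left _ _, hn.trans_le (by exact_mod_cast le_max_right _ _)⟩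
  have hF (i k) (hk : k₁ ≤ k) : edge (hγ i k) ∉ F := fun h => by
    have h1 := hM₁ _ h (γ i k) (by simp)
    have h2 := hesc i k
    have h3 : (k₁ : ℝ) ≤ k := by exact_mod_cast hk
    linarith [hk₁.2]
  -- The remaining highway edges that are to have time `a`; all other edges get time `b`.
  let Fast : (lattice d).edgeSet → Prop := fun e =>
    ∃ i k, k₁ ≤ k ∧ S i (k + 1) - S i k = a ∧ e.1 = s(γ i k, γ i (k + 1))
  let ω : Config d A := fun e => if e ∈ F then ω₀ e else if Fast e then ⟨a, ha⟩ else ⟨b, hb⟩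
  have hωF (e) (he : e ∈ F) : ω e = ω₀ e := by simp [ω, he]
  have hωa (e) (he : e ∉ F) (hf : Fast e) : (ω e : ℝ≥0) = a := by simp [ω, he, hf]
  have hωb (e) (he : e ∉ F) (hf : ¬ Fast e) : (ω e : ℝ≥0) = b := by simp [ω, he, hf]
  obtain ⟨g, hg, hgS⟩ := exists_lipschitzWith_extension (K := b)
    (fun j : ι × ℕ => emb (γ j.1 (j.2 + k₁))) (fun j => S j.1 (j.2 + k₁))
    fun _ _ => hlip _ _ _ _ (by omega) (by omega)
  let ψ : (Fin d → ℤ) → ℝ := fun z => max (g (emb z)) (N (emb z) - C)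
  have hψS (i k) (hk : k₁ ≤ k) : ψ (γ i k) = S i k := by
    obtain ⟨m, rfl⟩ := Nat.exists_eq_add_of_le' hk
    have := hgS (i, m)
    simp only [ψ]
    rw [this]
    exact max_eq_left (hNS _ _)
  have hψb (u v) (h : (lattice d).Adj u v) : ψ v - ψ u ≤ b := by
    have hd := dist_emb_of_adj h.symm
    have h1 := hg.dist_le_mul (emb v) (emb u)
    have h2 := hN.dist_le_mul (emb v) (emb u)
    rw [hd, mul_one, Real.dist_eq] at h1 h2
    have h3 := le_max_left (g (emb u)) (N (emb u) - C)
    have h4 := le_max_right (g (emb u)) (N (emb u) - C)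
    rw [sub_le_iff_le_add]
    exact max_le (by linarith [le_abs_self (g (emb v) - g (emb u))])
      (by linarith [le_abs_self (N (emb v) - N (emb u))])
  obtain ⟨M₂, hM₂⟩ := exists_bound_on_edges F ψ
  let M : ℝ := max M₂ (ψ 0)
  obtain ⟨B, hB⟩ := (Set.finite_range fun i =>
    ∑ j ∈ Finset.range k₁, ((ω (edge (hγ i j)) : ℝ≥0) : ℝ)).bddAbove
  refine ⟨ω, hωF, max B (C + M), fun i k => ?_, fun z => max (ψ z) M - M, ?_, ?_, fun z => ?_⟩
  · have hB' := hB ⟨i, rfl⟩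
    have key : ∑ j ∈ Finset.range k, ((ω (edge (hγ i j)) : ℝ≥0) : ℝ) ≤
        S i k + ∑ j ∈ Finset.range k₁, ((ω (edge (hγ i j)) : ℝ≥0) : ℝ) := by
      rcases le_total k k₁ with hk | hk
      · have h1 := Finset.sum_le_sum_of_subset_of_nonneg
          (f := fun j => ((ω (edge (hγ i j)) : ℝ≥0) : ℝ))
          (Finset.range_mono hk) fun _ _ _ => NNReal.coe_nonneg _
        have h2 := hmono i (Nat.zero_le k)
        rw [hS0] at h2
        linarith
      · induction k, hk using Nat.le_induction with
        | base =>
          have h2 := hmono i (Nat.zero_le k₁)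
          rw [hS0] at h2
          linarith
        | succ k hk ih =>
          rw [Finset.sum_range_succ]
          have h1 : ((ω (edge (hγ i k)) : ℝ≥0) : ℝ) ≤ S i (k + 1) - S i k := by
            by_cases hf : Fast (edge (hγ i k))
            · rw [hωa _ (hF i k hk) hf]
              rcases hS i k with h | h
              · exact h.ge
              -- An edge may lie on several paths, and have time `a` because of another one.
              · rw [h]
                obtain ⟨i', k', hk', hS', he⟩ := hf
                have h1 := hψS i' k' hk'
                have h2 := hψS i' (k' + 1) (by omega)
                have h3 := hψS i k hk
                have h4 := hψS i (k + 1) (by omega)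
                rcases Sym2.eq_iff.1 he with ⟨e1, e2⟩ | ⟨e1, e2⟩
                · rw [← e1] at h1; rw [← e2] at h2; linarith
                · rw [← e2] at h1; rw [← e1] at h2
                  linarith [a.coe_nonneg, b.coe_nonneg]
            · rw [hωb _ (hF i k hk) hf]
              rcases hS i k with h | h
              · exact absurd ⟨i, k, hk, h, rfl⟩ hf
              · exact h.ge
          linarith
    linarith [le_max_left B (C + M)]
  · simp [M]
  · intro u v h
    have hmax {x y c : ℝ} (hc : 0 ≤ c) (h : y - x ≤ c) : (max y M - M) - (max x M - M) ≤ c := by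
      rcases max_cases y M with h1 | h1 <;> rcases max_cases x M with h2 | h2 <;> linarith
    by_cases he : edge h ∈ F
    · have h1 := (hM₂ _ he u (by simp)).trans (le_max_left M₂ (ψ 0))
      have h2 := (hM₂ _ he v (by simp)).trans (le_max_left M₂ (ψ 0))
      simp only [max_eq_right (a := ψ u) (b := M) h1, max_eq_right (a := ψ v) (b := M) h2]
      simp
    · refine hmax (NNReal.coe_nonneg _) ?_
      by_cases hf : Fast (edge h)
      · rw [hωa _ he hf]
        obtain ⟨i, k, hk, hSk, he⟩ := hf
        have h1 := hψS i k hk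
        have h2 := hψS i (k + 1) (by omega)
        rcases Sym2.eq_iff.1 he with ⟨rfl, rfl⟩ | ⟨rfl, rfl⟩ <;> linarith [a.coe_nonneg]
      · rw [hωb _ he hf]
        exact hψb u v h
  · have h1 := le_max_right (g (emb z)) (N (emb z) - C)
    have h2 := le_max_left (ψ z) M
    have h3 := le_max_right B (C + M)
    have h4 : N (emb z) - C ≤ ψ z := h1
    linarith

lemma mul_norm_sub_le_two_mul_dist_smul {X : Type*} [NormedAddCommGroup X] [NormedSpace ℝ X] {u v : X}
    (hu : ‖u‖ = 1) (hv : ‖v‖ = 1) {k m : ℝ} (hk : 0 ≤ k) (hm : 0 ≤ m) :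
    k * ‖u - v‖ ≤ 2 * dist (k • u) (m • v) := by
  have h1 : |k - m| ≤ dist (k • u) (m • v) := by
    have := abs_norm_sub_norm_le (k • u) (m • v)
    rwa [norm_smul, norm_smul, hu, hv, mul_one, mul_one, Real.norm_of_nonneg hk,
      Real.norm_of_nonneg hm, ← dist_eq_norm] at this
  have h2 : k * ‖u - v‖ ≤ dist (k • u) (m • v) + |k - m| := by
    have h3 : dist (k • u) (k • v) = k * ‖u - v‖ := by
      rw [dist_eq_norm, ← smul_sub, norm_smul, Real.norm_of_nonneg hk]
    have h4 : dist (m • v) (k • v) = |k - m| := by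
      rw [dist_eq_norm, ← sub_smul, norm_smul, hv, mul_one, Real.norm_eq_abs, abs_sub_comm]
    rw [← h3, ← h4]
    exact dist_triangle _ _ _
  linarith

/-! ### The ball at one large time, stably in the configuration -/

lemma continuous_config_apply {d : ℕ} {A : Set ℝ≥0} (e : (lattice d).edgeSet) :
    Continuous fun ω : Config d A => ((ω e : ℝ≥0) : ℝ) :=
  NNReal.continuous_coe.comp (continuous_subtype_val.comp (continuous_apply e))

/-- A proper potential for `ω₁` controls the ball at time `t` for all configurations near `ω₁` in the
product topology: the potential may be truncated above the level `t`, so that only finitely many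
edges matter. -/
lemma eventually_ball_le_of_potential {d : ℕ} {A : Set ℝ≥0} (ω₁ : Config d A)
    (φ : (Fin d → ℤ) → ℝ) (h0 : φ 0 = 0)
    (hφ : ∀ u v (h : (lattice d).Adj u v), φ v - φ u ≤ (ω₁ (edge h) : ℝ≥0)) {c C : ℝ} (hc : 0 < c)
    (hproper : ∀ z, c * ‖emb z‖ - C ≤ φ z) {q : ℝ} (hq0 : 0 < q) (hq1 : q < 1) {t : ℝ}
    (ht : 0 ≤ t) : ∀ᶠ ω in 𝓝 ω₁, ∀ x ∈ ball ω t, q * φ (cell x) ≤ t := by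
  let M : ℝ := t / q + 1
  have hM : 0 ≤ M := by positivity
  have hfin : {u : Fin d → ℤ | φ u < M}.Finite :=
    (finite_norm_emb_le ((M + C) / c)).subset fun u hu => by
      have h1 := hproper u
      have h2 : φ u < M := hu
      rw [Set.mem_ofPred_eq, le_div_iff₀ hc]
      linarith
  have hfin' : {v : Fin d → ℤ | ‖emb v‖ ≤ (M + C) / c + 1}.Finite := finite_norm_emb_le _
  have hev : ∀ᶠ ω in 𝓝 ω₁, ∀ u ∈ {u : Fin d → ℤ | φ u < M},
      ∀ v ∈ {v : Fin d → ℤ | ‖emb v‖ ≤ (M + C) / c + 1}, ∀ h : (lattice d).Adj u v,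
      q * (ω₁ (edge h) : ℝ≥0) ≤ (ω (edge h) : ℝ≥0) := by
    rw [eventually_all_finite hfin]
    intro u _
    rw [eventually_all_finite hfin']
    intro v _
    by_cases h : (lattice d).Adj u v
    · simp only [h, forall_true_left]
      rcases (NNReal.coe_nonneg (ω₁ (edge h) : ℝ≥0)).eq_or_lt with h1 | h1
      · simp [← h1]
      · exact ((continuous_config_apply (edge h)).continuousAt.eventually_const_lt
          (by nlinarith)).mono fun ω h => h.le
    · simp [h]
  filter_upwards [hev] with ω hω x hx
  have key := sub_le_of_passageTime_le ω (fun z => q * min (φ z) M) (fun u v h => ?_) ht hx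
  · simp only [h0, min_eq_left hM, mul_zero, sub_zero] at key
    have h1 : min (φ (cell x)) M ≤ t / q := by rw [le_div_iff₀ hq0]; linarith
    have h2 : φ (cell x) ≤ t / q := by
      rcases min_le_iff.1 h1 with h | h
      · exact h
      · simp only [M] at h; linarith
    rw [le_div_iff₀ hq0] at h2
    linarith
  · rw [← mul_sub]
    rcases lt_or_ge (φ u) M with hu | hu
    · have hv : ‖emb v‖ ≤ (M + C) / c + 1 := by
        have h1 : ‖emb u‖ ≤ (M + C) / c := by
          rw [le_div_iff₀ hc]
          linarith [hproper u]
        have h2 := dist_emb_of_adj h.symm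
        rw [dist_eq_norm] at h2
        linarith [norm_le_norm_add_norm_sub' (emb v) (emb u)]
      refine le_trans (mul_le_mul_of_nonneg_left ?_ hq0.le) (hω u hu v hv h)
      rw [min_eq_left hu.le]
      linarith [hφ u v h, min_le_left (φ v) M]
    · rw [min_eq_right hu]
      refine le_trans ?_ (NNReal.coe_nonneg _)
      exact mul_nonpos_of_nonneg_of_nonpos hq0.le (by linarith [min_le_right (φ v) M])

/-- Geodesics in distinct directions, with traversal times close to a function `N` that is Lipschitz
with a constant `b' < b`, are consistent with the speed `1 / b` off the geodesics, once their initial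
parts are discarded: the distance between two of them grows linearly, while the times differ from `N`
by a bounded amount. For `a = b` the times are exactly the multiples of `b`. -/
lemma exists_le_mul_dist_of_geodesics {d : ℕ} {a b : ℝ≥0} {N : Space d → ℝ}
    (hslack : (∃ b' < b, LipschitzWith b' N) ∨ a = b) {ι : Type*} [Finite ι] (u : ι → Space d)
    (hu : ∀ i, ‖u i‖ = 1) (hinj : Function.Injective u) (γ : ι → ℕ → Fin d → ℤ)
    (hγ0 : ∀ i, γ i 0 = 0) (hγ : ∀ i k, (lattice d).Adj (γ i k) (γ i (k + 1)))
    (hγu : ∀ i (k : ℕ), dist (emb (γ i k)) ((k : ℝ) • u i) ≤ 2 * d)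
    (hγd : ∀ i (k m : ℕ), |(k : ℝ) - m| ≤ dist (emb (γ i k)) (emb (γ i m)))
    (S : ι → ℕ → ℝ) (hS0 : ∀ i, S i 0 = 0) (hab : a ≤ b)
    (hS : ∀ i k, S i (k + 1) - S i k = a ∨ S i (k + 1) - S i k = b) {C : ℝ}
    (hSN : ∀ i k, |S i k - N (emb (γ i k))| ≤ C) :
    ∃ k₀ : ℕ, ∀ i j k m, k₀ ≤ k → k₀ ≤ m →
      S i k - S j m ≤ b * dist (emb (γ i k)) (emb (γ j m)) := by
  rcases hslack with ⟨b', hb', hN⟩ | rfl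
  · have hab' : (a : ℝ) ≤ b := hab
    have hbb' : (b' : ℝ) < b := hb'
    have hsame (i k m) : S i k - S i m ≤ b * dist (emb (γ i k)) (emb (γ i m)) := by
      refine le_trans ?_ (mul_le_mul_of_nonneg_left (hγd i k m) b.coe_nonneg)
      rcases le_total k m with h | h
      · have hmono : Monotone (S i) := monotone_nat_of_le_succ fun k => by
          rcases hS i k with h | h <;> linarith [a.coe_nonneg, b.coe_nonneg]
        have := hmono h
        have : 0 ≤ (b : ℝ) * |(k : ℝ) - m| := by positivity
        linarith
      · have hanti : Antitone fun k : ℕ => S i k - b * k := antitone_nat_of_succ_le fun k => by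
          push_cast
          rcases hS i k with h | h <;> linarith
        have := hanti h
        have h2 : (m : ℝ) ≤ k := by exact_mod_cast h
        rw [abs_of_nonneg (by linarith)]
        simp only at this
        linarith
    have hsep (i j) : ∀ᶠ k₀ : ℕ in atTop, i ≠ j →
        2 * C + (b - b') * (4 * d) ≤ (b - b') * (k₀ * (‖u i - u j‖ / 2)) := by
      rcases eq_or_ne i j with rfl | hij
      · simp
      · have hpos : 0 < ‖u i - u j‖ := norm_pos_iff.2 (sub_ne_zero.2 (hinj.ne hij))
        have : Tendsto (fun k₀ : ℕ => ((b : ℝ) - b') * (k₀ * (‖u i - u j‖ / 2))) atTop atTop :=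
          Tendsto.const_mul_atTop (by linarith)
            (tendsto_natCast_atTop_atTop.atTop_mul_const (by linarith))
        filter_upwards [this.eventually_ge_atTop (2 * C + (b - b') * (4 * d))] with k hk _
        exact hk
    obtain ⟨k₀, hk₀⟩ := (eventually_all.2 fun i => eventually_all.2 fun j => hsep i j).exists
    refine ⟨k₀, fun i j k m hk hm => ?_⟩
    rcases eq_or_ne i j with rfl | hij
    · exact hsame i k m
    · have h1 := hk₀ i j hij
      have h2 := mul_norm_sub_le_two_mul_dist_smul (hu i) (hu j) k.cast_nonneg m.cast_nonneg
      have h3 : (k₀ : ℝ) * ‖u i - u j‖ ≤ k * ‖u i - u j‖ := by gcongr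
      have h4 : dist ((k : ℝ) • u i) ((m : ℝ) • u j) ≤
          2 * d + dist (emb (γ i k)) (emb (γ j m)) + 2 * d := by
        refine (dist_triangle4 _ (emb (γ i k)) (emb (γ j m)) _).trans ?_
        have := hγu i k
        rw [dist_comm] at this
        linarith [hγu j m]
      have h5 := hN.dist_le_mul (emb (γ i k)) (emb (γ j m))
      rw [Real.dist_eq] at h5
      have h6 := abs_le.1 (hSN i k)
      have h7 := abs_le.1 (hSN j m)
      have h8 := le_abs_self (N (emb (γ i k)) - N (emb (γ j m)))
      have h9 : ((b : ℝ) - b') * (k₀ * (‖u i - u j‖ / 2) - 4 * d) ≤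
          (b - b') * dist (emb (γ i k)) (emb (γ j m)) :=
        mul_le_mul_of_nonneg_left (by linarith) (by linarith)
      nlinarith
  · refine ⟨0, fun i j k m _ _ => ?_⟩
    have hSk (i) (k : ℕ) : S i k = a * k := by
      induction k with
      | zero => simp [hS0]
      | succ k ih => push_cast; rcases hS i k with h | h <;> linarith
    rw [hSk, hSk, ← mul_sub]
    refine mul_le_mul_of_nonneg_left ?_ a.coe_nonneg
    have h1 : (k : ℝ) ≤ ‖emb (γ i k)‖ := by simpa [hγ0] using hγd i k 0
    have h2 : ‖emb (γ j m)‖ ≤ m := by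
      induction m with
      | zero => simp [hγ0]
      | succ m ih =>
        have := dist_emb_of_adj (hγ j m).symm
        rw [dist_eq_norm] at this
        push_cast
        linarith [ih m.zero_le, norm_le_norm_add_norm_sub' (emb (γ j (m + 1))) (emb (γ j m))]
    rw [dist_eq_norm]
    linarith [norm_sub_norm_le (emb (γ i k)) (emb (γ j m))]

lemma exists_finite_net_directions {d : ℕ} (hd : 0 < d) {δ : ℝ} (hδ : 0 < δ) :
    ∃ U : Set (Space d), U.Finite ∧ (∀ u ∈ U, ‖u‖ = 1) ∧
      ∀ p, ∃ u ∈ U, ‖p - ‖p‖ • u‖ ≤ δ * ‖p‖ := by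
  have : Nonempty (Fin d) := ⟨⟨0, hd⟩⟩
  have : Nontrivial (Space d) := (WithLp.toLp_injective 1).nontrivial
  obtain ⟨U, hU, hfin, hcov⟩ := (isCompact_sphere (0 : Space d) 1).finite_cover_balls hδ
  have hnet (w : Space d) (hw : ‖w‖ = 1) : ∃ u ∈ U, ‖w - u‖ ≤ δ := by
    obtain ⟨u, hu, hwu⟩ := Set.mem_iUnion₂.1 (hcov (show w ∈ _ by simpa using hw))
    exact ⟨u, hu, by rw [← dist_eq_norm]; exact (Metric.mem_ball.1 hwu).le⟩
  refine ⟨U, hfin, fun u hu => by simpa using hU hu, fun p => ?_⟩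
  rcases eq_or_ne p 0 with rfl | hp
  · obtain ⟨w, hw⟩ := exists_norm_eq (Space d) zero_le_one
    obtain ⟨u, hu, -⟩ := hnet w hw
    exact ⟨u, hu, by simp⟩
  · have hp' : ‖p‖ ≠ 0 := norm_ne_zero_iff.2 hp
    obtain ⟨u, hu, h⟩ := hnet (‖p‖⁻¹ • p) (by rw [norm_smul, norm_inv, norm_norm,
      inv_mul_cancel₀ hp'])
    refine ⟨u, hu, ?_⟩
    have : p - ‖p‖ • u = ‖p‖ • (‖p‖⁻¹ • p - u) := by
      rw [smul_sub, smul_smul, mul_inv_cancel₀ hp', one_smul]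
    rw [this, norm_smul, norm_norm, mul_comm]
    gcongr

/-- For a positively homogeneous Lipschitz function `N` that is compatible with edge times `a` and
`b`, some configuration prescribed on finitely many edges, and all configurations close to it, have
at some large time `t` a ball close to `{N ≤ t}`. -/
lemma exists_config_ball_near {d : ℕ} (hd : 0 < d) {A : Set ℝ≥0} {a b : ℝ≥0} (ha : a ∈ A)
    (hb : b ∈ A) (hab : a ≤ b) {N : Space d → ℝ} (hN : LipschitzWith b N)
    (hslack : (∃ b' < b, LipschitzWith b' N) ∨ a = b)
    (hhom : ∀ s : ℝ, 0 ≤ s → ∀ x, N (s • x) = s * N x) (hNa : ∀ x, a * ‖x‖ ≤ N x)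
    {c : ℝ} (hc : 0 < c) (hNc : ∀ x, c * ‖x‖ ≤ N x)
    (ω₀ : Config d A) (F : Finset (lattice d).edgeSet) {ε : ℝ} (hε : 0 < ε) (T : ℝ) :
    ∃ ω₁ : Config d A, (∀ e ∈ F, ω₁ e = ω₀ e) ∧ ∃ t : ℝ, T ≤ t ∧ 0 < t ∧ ∀ᶠ ω in 𝓝 ω₁,
      (∀ x ∈ ball ω t, N x ≤ (1 + ε) * t) ∧
      ∀ p, N p ≤ 1 → ∃ y ∈ ball ω t, dist (t • p) y ≤ ε * t := by
  have hb0 : (0 : ℝ) ≤ b := b.coe_nonneg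
  have hN0 : N 0 = 0 := by simpa using hhom 0 le_rfl 0
  have hNb (x) : N x ≤ b * ‖x‖ := by
    have := hN.dist_le_mul x 0
    rw [dist_zero_right, Real.dist_eq, hN0, sub_zero] at this
    exact (le_abs_self _).trans this
  -- The highways: finitely many directions, each travelled at the speed prescribed by `N`.
  let R : ℝ := 1 / c
  have hR : 0 < R := by positivity
  let δ : ℝ := ε / (2 * (R + b * R ^ 2))
  have hδ : 0 < δ := by positivity
  have hδε : δ * (R + b * R ^ 2) = ε / 2 := by
    simp only [δ]
    field_simp
  obtain ⟨U, hUfin, hU1, hUnet⟩ := exists_finite_net_directions hd hδ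
  have : Finite U := hUfin
  choose γ hγ0 hγ hγu hγd using fun i : U => exists_geodesic (i : Space d) (hU1 i i.2)
  choose S hS0 hS hSρ using fun i : U => exists_weights (a := a) (b := b) (ρ := N i)
    (by simpa [hU1 i i.2] using hNa i) (by simpa [hU1 i i.2] using hNb i)
  have hesc (i) (k : ℕ) : (k : ℝ) ≤ ‖emb (γ i k)‖ := by simpa [hγ0] using hγd i k 0
  have hNk (i : U) (k : ℕ) : |N (emb (γ i k)) - N i * k| ≤ b * (2 * d) := by
    have h1 := hN.dist_le_mul (emb (γ i k)) ((k : ℝ) • (i : Space d))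
    rw [hhom _ k.cast_nonneg, Real.dist_eq, mul_comm (k : ℝ)] at h1
    exact h1.trans (mul_le_mul_of_nonneg_left (hγu i k) hb0)
  have hSN (i) (k : ℕ) : |S i k - N (emb (γ i k))| ≤ b + b * (2 * d) := by
    have h1 := abs_le.1 (hNk i k)
    have h2 := hSρ i k
    rw [abs_le]
    constructor <;> linarith [a.coe_nonneg]
  obtain ⟨k₀, hk₀⟩ := exists_le_mul_dist_of_geodesics hslack (fun i : U => (i : Space d))
    (fun i => hU1 i i.2) Subtype.val_injective γ hγ0 hγ hγu hγd S hS0 hab hS hSN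
  obtain ⟨ω₁, hω₁F, C, hup, φ, hφ0, hφ, hφN⟩ := exists_config_of_highways ha hb ω₀ F γ hγ hesc S
    hS0 hS k₀ hk₀ hN (C := b + b * (2 * d)) (fun i k => by linarith [(abs_le.1 (hSN i k)).1])
  let C₂ : ℝ := |C| + 1
  obtain ⟨t, htT, ht0, htC, ht1, ht2⟩ : ∃ t : ℝ, T ≤ t ∧ 0 < t ∧ C₂ ≤ t ∧
      C₂ * R + 1 + 2 * d ≤ ε / 2 * t ∧ C + b * d ≤ ε / 2 * t := by
    have h1 : Tendsto (fun t : ℝ => ε / 2 * t) atTop atTop :=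
      tendsto_id.const_mul_atTop (by linarith)
    exact (((eventually_ge_atTop T).and ((eventually_gt_atTop 0).and ((eventually_ge_atTop C₂).and
      ((h1.eventually_ge_atTop _).and (h1.eventually_ge_atTop _)))))).exists
  refine ⟨ω₁, hω₁F, t, htT, ht0, ?_⟩
  have hlow := eventually_ball_le_of_potential ω₁ φ hφ0 hφ hc (C := C)
    (fun z => by linarith [hφN z, hNc (emb z)]) (q := 1 / (1 + ε / 2)) (by positivity)
    (by rw [div_lt_one (by positivity)]; linarith) ht0.le
  have hsums : ∀ᶠ ω in 𝓝 ω₁, ∀ i, ∀ k ∈ Finset.range (⌊t * R⌋₊ + 1),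
      ∑ j ∈ Finset.range k, ((ω (edge (hγ i j)) : ℝ≥0) : ℝ) < S i k + C + 1 := by
    refine eventually_all.2 fun i => (eventually_all_finset _).2 fun k _ => ?_
    have hcont : Continuous fun ω : Config d A =>
        ∑ j ∈ Finset.range k, ((ω (edge (hγ i j)) : ℝ≥0) : ℝ) :=
      continuous_finsetSum _ fun j _ => continuous_config_apply _
    exact hcont.continuousAt.eventually_lt_const (by linarith [hup i k])
  filter_upwards [hlow, hsums] with ω hω hωs
  constructor
  · intro x hx
    have h1 := hω x hx
    rw [one_div, inv_mul_le_iff₀ (by positivity)] at h1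
    have h2 := hN.dist_le_mul x (emb (cell x))
    rw [Real.dist_eq] at h2
    have h3 := mul_le_mul_of_nonneg_left (dist_emb_cell_le x) hb0
    linarith [le_abs_self (N x - N (emb (cell x))), hφN (cell x)]
  · intro p hp
    obtain ⟨u, hu, hpu⟩ := hUnet p
    have hpR : ‖p‖ ≤ R := by
      simp only [R]
      rw [le_div_iff₀ hc]
      linarith [hNc p]
    have hp0 := norm_nonneg p
    have hC₂ : 0 ≤ C₂ := by positivity
    -- Near `t • p`, the highway in the direction `u` is reached by time `t` up to distance `τ * ‖p‖`.
    let κ : ℝ := b * δ * R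
    have hκ : 0 ≤ κ := by positivity
    let τ : ℝ := (t - C₂) / (1 + κ)
    have hτ0 : 0 ≤ τ := div_nonneg (by linarith) (by linarith)
    have hτ : τ * (1 + κ) = t - C₂ := div_mul_cancel₀ _ (by positivity)
    have hτt : τ ≤ t := by nlinarith
    have hδp : δ * ‖p‖ ≤ δ * R := by gcongr
    have hρ : N u * ‖p‖ ≤ 1 + κ := by
      have h1 := hN.dist_le_mul (‖p‖ • u) p
      rw [hhom _ hp0, Real.dist_eq, dist_comm, dist_eq_norm, mul_comm ‖p‖] at h1
      have h2 : b * ‖p - ‖p‖ • u‖ ≤ κ := by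
        simp only [κ]
        rw [mul_assoc]
        exact mul_le_mul_of_nonneg_left (hpu.trans hδp) hb0
      linarith [le_abs_self (N u * ‖p‖ - N p)]
    let k : ℕ := ⌊τ * ‖p‖⌋₊
    have hk1 : (k : ℝ) ≤ τ * ‖p‖ := Nat.floor_le (by positivity)
    have hk2 : τ * ‖p‖ < k + 1 := Nat.lt_floor_add_one _
    refine ⟨emb (γ ⟨u, hu⟩ k), ?_, ?_⟩
    · refine emb_mem_ball_of_sum_le ω _ (hγ0 _) (hγ _) ?_
      have hmem : k ∈ Finset.range (⌊t * R⌋₊ + 1) := by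
        rw [Finset.mem_range]
        exact Nat.lt_succ_of_le (Nat.floor_le_floor (by gcongr))
      have h1 := hωs ⟨u, hu⟩ k hmem
      have h2 := (hSρ ⟨u, hu⟩ k).1
      have hNu : 0 ≤ N u := le_trans (by positivity) (hNc u)
      have h3 : N u * k ≤ t - C₂ := by
        calc N u * k ≤ N u * (τ * ‖p‖) := by gcongr
          _ = τ * (N u * ‖p‖) := by ring
          _ ≤ τ * (1 + κ) := by gcongr
          _ = t - C₂ := hτ
      simp only at h2
      simp only [C₂] at h3
      linarith [le_abs_self C]
    · have h1 : dist (t • p) ((t * ‖p‖) • u) ≤ t * (δ * R) := by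
        rw [dist_eq_norm, ← smul_smul, ← smul_sub, norm_smul, Real.norm_of_nonneg ht0.le]
        gcongr
        exact hpu.trans hδp
      have h2 : dist ((t * ‖p‖) • u) ((k : ℝ) • u) ≤ (t * κ + C₂) * R + 1 := by
        have h4 : (t - τ) * ‖p‖ ≤ (t * κ + C₂) * R := by
          have h5 : t - τ ≤ t * κ + C₂ := by nlinarith
          gcongr
        have h5 : τ * ‖p‖ ≤ t * ‖p‖ := by gcongr
        rw [dist_eq_norm, ← sub_smul, norm_smul, hU1 u hu, mul_one, Real.norm_eq_abs,
          abs_of_nonneg (by linarith)]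
        linarith
      have h3 := hγu ⟨u, hu⟩ k
      rw [dist_comm] at h3
      have h4 := dist_triangle4 (t • p) ((t * ‖p‖) • u) ((k : ℝ) • u) (emb (γ ⟨u, hu⟩ k))
      have h5 : t * (δ * R) + t * κ * R = ε / 2 * t := by
        rw [← hδε]
        simp only [κ]
        ring
      simp only at h3
      linarith

/-! ### Approximating a convex shape -/

lemma mem_diamond_inv {d : ℕ} {x : Space d} {r : ℝ≥0} :
    x ∈ diamond d (r : ℝ≥0∞)⁻¹ ↔ r * ‖x‖ ≤ 1 := by
  rw [diamond, Metric.mem_closedEBall, edist_zero_right, ENNReal.le_inv_iff_mul_le, mul_comm]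
  rw [enorm_eq_nnnorm]
  norm_cast

/-- A convex shape `K` is nearly the set `{N ≤ 1}` for a function `N` to which
`exists_config_ball_near` applies. Unless all edge times are equal, `N` is the maximum of a small
multiple of the norm and the gauge of a neighbourhood of `K`. Passing to the neighbourhood enlarges the
diamond inside `K` and so makes the Lipschitz constant strictly smaller than `sup A`. -/
lemma exists_profile {d : ℕ} (hd : 0 < d) {A : Set ℝ≥0} (hA : A.Nonempty) {K : Set (Space d)}
    (hK : K ∈ shapes d A) (hconv : Convex ℝ K) {η : ℝ} (hη : 0 < η) :
    ∃ a ∈ A, ∃ b ∈ A, a ≤ b ∧ ∃ N : Space d → ℝ, LipschitzWith b N ∧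
      ((∃ b' < b, LipschitzWith b' N) ∨ a = b) ∧
      (∀ s : ℝ, 0 ≤ s → ∀ x, N (s • x) = s * N x) ∧ (∀ x, a * ‖x‖ ≤ N x) ∧
      (∃ c > 0, ∀ x, c * ‖x‖ ≤ N x) ∧ (∀ x ∈ K, N x ≤ 1 + η) ∧
      ∀ x, N x ≤ 1 → ∃ y ∈ K, dist x y ≤ η := by
  obtain ⟨-, hcomp, hsub, hsup⟩ := hK
  obtain ⟨a₀, ha₀⟩ := hA
  have hinf : (⨅ a ∈ A, (a : ℝ≥0∞)) ≤ a₀ := iInf₂_le a₀ ha₀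
  have hsupA : (a₀ : ℝ≥0∞) ≤ ⨆ a ∈ A, (a : ℝ≥0∞) :=
    le_iSup₂ (f := fun (a : ℝ≥0) (_ : a ∈ A) => (a : ℝ≥0∞)) a₀ ha₀
  rcases (hinf.trans hsupA).eq_or_lt with heq | hlt
  · have h1 : (⨅ a ∈ A, (a : ℝ≥0∞)) = a₀ := le_antisymm hinf (heq ▸ hsupA)
    rw [h1] at hsup
    rw [← heq, h1] at hsub
    have hapos : 0 < a₀ := by
      rw [pos_iff_ne_zero]
      rintro rfl
      have : Nonempty (Fin d) := ⟨⟨0, hd⟩⟩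
      have : Nontrivial (Space d) := (WithLp.toLp_injective 1).nontrivial
      have := NormedSpace.noncompactSpace ℝ (Space d)
      have huniv : K = Set.univ := Set.eq_univ_of_forall fun x => hsub (mem_diamond_inv.2 (by simp))
      exact noncompact_univ (Space d) (huniv ▸ hcomp)
    refine ⟨a₀, ha₀, a₀, ha₀, le_rfl, fun x => a₀ * ‖x‖, ?_, Or.inr rfl, fun s hs x => ?_,
      fun _ => le_rfl, ⟨a₀, hapos, fun _ => le_rfl⟩, fun x hx => ?_, fun x hx => ?_⟩
    · refine LipschitzWith.of_le_add_mul _ fun x y => ?_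
      rw [← mul_add, dist_eq_norm]
      gcongr
      exact norm_le_norm_add_norm_sub' x y
    · simp only [norm_smul, Real.norm_of_nonneg hs]; ring
    · linarith [mem_diamond_inv.1 (hsup hx)]
    · exact ⟨x, hsub (mem_diamond_inv.2 hx), by simpa using hη.le⟩
  · obtain ⟨α, hα⟩ : ∃ α : ℝ≥0, (α : ℝ≥0∞) = ⨅ a ∈ A, (a : ℝ≥0∞) :=
      ⟨_, ENNReal.coe_toNNReal (hinf.trans_lt ENNReal.coe_lt_top).ne⟩
    rw [← hα] at hlt hsup
    obtain ⟨r, hr⟩ : ∃ r : ℝ≥0, (r : ℝ≥0∞) = (⨆ a ∈ A, (a : ℝ≥0∞))⁻¹ :=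
      ⟨_, ENNReal.coe_toNNReal (ENNReal.inv_ne_top.2 (pos_of_gt hlt).ne')⟩
    rw [← hr, diamond, Metric.closedEBall_coe] at hsub
    have hαr : (α : ℝ) * r < 1 := by
      have h1 : (r : ℝ≥0∞) < 1 / α := by rw [hr, one_div]; exact ENNReal.inv_lt_inv.2 hlt
      have h2 := ENNReal.mul_lt_of_lt_div h1
      rw [mul_comm]
      exact_mod_cast h2
    obtain ⟨R, hR0, hKR⟩ := hcomp.isBounded.subset_closedBall_lt 0 (0 : Space d)
    obtain ⟨δ, hδ0, hδη, hδα⟩ : ∃ δ : ℝ≥0, 0 < δ ∧ (δ : ℝ) ≤ η ∧ (α : ℝ) * (r + δ) < 1 := by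
      have hcont : Continuous fun δ : ℝ≥0 => (α : ℝ) * (r + δ) := by fun_prop
      have h1 : ∀ᶠ δ : ℝ≥0 in 𝓝[>] 0, (α : ℝ) * (r + δ) < 1 :=
        (hcont.continuousAt.eventually_lt_const (by simpa using hαr)).filter_mono
          nhdsWithin_le_nhds
      have h2 : ∀ᶠ δ : ℝ≥0 in 𝓝[>] 0, (δ : ℝ) < η :=
        (NNReal.continuous_coe.continuousAt.eventually_lt_const (by simpa using hη)).filter_mono
          nhdsWithin_le_nhds
      obtain ⟨δ, h3, h4, h5⟩ := (h1.and (h2.and self_mem_nhdsWithin)).exists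
      exact ⟨δ, h5, h4.le, h3⟩
    let b' : ℝ≥0 := (r + δ)⁻¹
    have hrδ : 0 < r + δ := by positivity
    have hb'sup : (b' : ℝ≥0∞) < ⨆ a ∈ A, (a : ℝ≥0∞) := by
      rw [← inv_inv (⨆ a ∈ A, (a : ℝ≥0∞)), ← hr, ENNReal.coe_inv hrδ.ne', ENNReal.inv_lt_inv]
      exact_mod_cast lt_add_of_pos_right r hδ0
    have hαb' : α < b' := by
      have h : α * (r + δ) < 1 := by exact_mod_cast hδα
      simp only [b']
      rwa [← one_div, lt_div_iff₀ hrδ]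
    obtain ⟨b, hbA, hb⟩ : ∃ b ∈ A, b' < b := by simpa [lt_iSup_iff] using hb'sup
    obtain ⟨a, haA, ha⟩ : ∃ a ∈ A, a < min b' (α + (η / R).toNNReal) := by
      have h : (⨅ a ∈ A, (a : ℝ≥0∞)) < (min b' (α + (η / R).toNNReal) : ℝ≥0) := by
        rw [← hα, ENNReal.coe_lt_coe, lt_min_iff]
        refine ⟨hαb', lt_add_of_pos_right _ ?_⟩
        exact Real.toNNReal_pos.2 (div_pos hη hR0)
      simpa only [iInf_lt_iff, exists_prop, ENNReal.coe_lt_coe] using h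
    obtain ⟨hab', haα⟩ := lt_min_iff.1 ha
    have haα' : (a : ℝ) < α + η / R := by
      rw [← Real.coe_toNNReal (η / R) (by positivity)]
      exact_mod_cast haα
    let s : Set (Space d) := K + Metric.closedBall 0 δ
    have hsconv : Convex ℝ s := hconv.add (convex_closedBall _ _)
    have hsclosed : IsClosed s := (hcomp.add (isCompact_closedBall _ _)).isClosed
    have hKs : K ⊆ s := fun x hx =>
      Set.mem_add.2 ⟨x, hx, 0, by simp, add_zero x⟩
    have hball : Metric.closedBall (0 : Space d) (r + δ : ℝ≥0) ⊆ s := by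
      have := closedBall_add_closedBall (δ := δ) r.coe_nonneg δ.coe_nonneg (0 : Space d) 0
      rw [add_zero] at this
      rw [NNReal.coe_add, ← this]
      exact Set.add_subset_add_right hsub
    have hs0 : s ∈ 𝓝 (0 : Space d) :=
      mem_of_superset (Metric.closedBall_mem_nhds _ (by exact_mod_cast hrδ)) hball
    have hsR : s ⊆ Metric.closedBall 0 (R + δ) := by
      have := closedBall_add_closedBall hR0.le δ.coe_nonneg (0 : Space d) 0
      rw [add_zero] at this
      rw [← this]
      exact Set.add_subset_add_right hKR
    have hnormlip : LipschitzWith a fun x : Space d => a * ‖x‖ := by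
      refine LipschitzWith.of_le_add_mul _ fun x y => ?_
      rw [← mul_add, dist_eq_norm]
      gcongr
      exact norm_le_norm_add_norm_sub' x y
    have hlip : LipschitzWith b' fun x : Space d => max (a * ‖x‖) (gauge s x) := by
      have := hnormlip.max (hsconv.lipschitzWith_gauge hrδ (Metric.ball_subset_closedBall.trans hball))
      exact this.weaken (max_le hab'.le le_rfl)
    refine ⟨a, haA, b, hbA, (hab'.trans hb).le, _, hlip.weaken hb.le, Or.inl ⟨b', hb, hlip⟩,
      fun t ht x => ?_, fun x => le_max_left _ _, ⟨1 / (R + δ), by positivity, fun x => ?_⟩,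
      fun x hx => max_le ?_ ?_, fun x hx => ?_⟩
    · rw [norm_smul, Real.norm_of_nonneg ht, gauge_smul_of_nonneg ht, smul_eq_mul,
        mul_max_of_nonneg _ _ ht]
      ring_nf
    · refine le_trans ?_ (le_max_right _ _)
      have := le_gauge_of_subset_closedBall (x := x) (absorbent_nhds_zero hs0) (by positivity) hsR
      rwa [one_div_mul_eq_div]
    · have h1 := mem_diamond_inv.1 (hsup hx)
      have h2 : ‖x‖ ≤ R := by simpa using hKR hx
      have h3 : (a : ℝ) * ‖x‖ ≤ (α + η / R) * ‖x‖ := by gcongr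
      have h4 : η / R * ‖x‖ ≤ η / R * R := by gcongr
      rw [div_mul_cancel₀ _ hR0.ne'] at h4
      linarith
    · linarith [gauge_le_one_of_mem (hKs hx)]
    · have h1 := (gauge_le_one_iff_mem_closure hsconv hs0).1 ((le_max_right _ _).trans hx)
      rw [hsclosed.closure_eq] at h1
      obtain ⟨y, hy, e, he, rfl⟩ := Set.mem_add.1 h1
      refine ⟨y, hy, ?_⟩
      rw [mem_closedBall_zero_iff] at he
      simpa using he.trans hδη

lemma exists_config_hausdorffEDist_le {d : ℕ} (hd : 0 < d) {A : Set ℝ≥0} {K : Set (Space d)}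
    (hK : K ∈ shapes d A) (hconv : Convex ℝ K) (ω₀ : Config d A) (F : Finset (lattice d).edgeSet)
    {ε : ℝ} (hε : 0 < ε) (T : ℝ) :
    ∃ ω₁ : Config d A, (∀ e ∈ F, ω₁ e = ω₀ e) ∧ ∃ t : ℝ, T ≤ t ∧ ∀ᶠ ω in 𝓝 ω₁,
      Metric.hausdorffEDist (t⁻¹ • ball ω t) K ≤ ENNReal.ofReal ε := by
  have hA : A.Nonempty := by
    have h : (lattice d).Adj 0 (Pi.single ⟨0, hd⟩ 1) := by
      change ∑ i, |(0 : Fin d → ℤ) i - Pi.single (M := fun _ => ℤ) ⟨0, hd⟩ 1 i| = 1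
      rw [Finset.sum_eq_single ⟨0, hd⟩] <;> simp +contextual
    exact ⟨ω₀ (edge h), (ω₀ (edge h)).2⟩
  obtain ⟨R, hR0, hKR⟩ := hK.2.1.isBounded.subset_closedBall_lt 0 (0 : Space d)
  let η : ℝ := ε / (2 * (R + 1))
  have hη : 0 < η := by positivity
  have hηR : η * R + η = ε / 2 := by simp only [η]; field_simp
  have hηR0 : 0 < η * R := by positivity
  obtain ⟨a, ha, b, hb, hab, N, hN, hslack, hhom, hNa, ⟨c, hc, hNc⟩, hKN, hNK⟩ :=
    exists_profile hd hA hK hconv hη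
  let ε' : ℝ := min (ε / 2) (c * (ε / 2))
  have hε' : 0 < ε' := lt_min (by positivity) (by positivity)
  have hscale {s : ℝ} (hs : 0 < s) {x : Space d} (hx : N x ≤ 1 + s) :
      N ((1 + s)⁻¹ • x) ≤ 1 ∧ dist x ((1 + s)⁻¹ • x) = s * ‖(1 + s)⁻¹ • x‖ := by
    constructor
    · rw [hhom _ (by positivity), inv_mul_le_iff₀ (by positivity)]
      linarith
    · have h : x - (1 + s)⁻¹ • x = s • ((1 + s)⁻¹ • x) := by
        have : x = (1 + s) • ((1 + s)⁻¹ • x) := by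
          rw [smul_smul, mul_inv_cancel₀ (by positivity), one_smul]
        nth_rewrite 1 [this]
        rw [add_smul, one_smul, add_sub_cancel_left]
      rw [dist_eq_norm, h, norm_smul, Real.norm_of_nonneg hs.le]
  obtain ⟨ω₁, hω₁, t, hT, ht, hev⟩ :=
    exists_config_ball_near hd ha hb hab hN hslack hhom hNa hc hNc ω₀ F hε' T
  refine ⟨ω₁, hω₁, t, hT, hev.mono fun ω hω => ?_⟩
  refine Metric.hausdorffEDist_le_of_mem_edist ?_ ?_
  · rintro _ ⟨z, hz, rfl⟩
    have h1 : N (t⁻¹ • z) ≤ 1 + ε' := by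
      rw [hhom _ (by positivity), inv_mul_le_iff₀ ht]
      linarith [hω.1 z hz]
    obtain ⟨h2, h3⟩ := hscale hε' h1
    obtain ⟨y, hy, h4⟩ := hNK _ h2
    refine ⟨y, hy, ?_⟩
    rw [edist_dist]
    refine ENNReal.ofReal_le_ofReal ?_
    have h5 := (hNc _).trans h2
    have h6 : ε' * ‖(1 + ε')⁻¹ • (t⁻¹ • z)‖ ≤
        c * (ε / 2) * ‖(1 + ε')⁻¹ • (t⁻¹ • z)‖ := by
      gcongr
      exact min_le_right _ _
    have h7 := dist_triangle (t⁻¹ • z) ((1 + ε')⁻¹ • (t⁻¹ • z)) y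
    simp only
    nlinarith
  · intro p hp
    obtain ⟨h2, h3⟩ := hscale hη (hKN p hp)
    obtain ⟨z, hz, h4⟩ := hω.2 _ h2
    refine ⟨t⁻¹ • z, Set.smul_mem_smul_set hz, ?_⟩
    rw [edist_dist]
    refine ENNReal.ofReal_le_ofReal ?_
    have h5 : dist ((1 + η)⁻¹ • p) (t⁻¹ • z) ≤ ε' := by
      have : (1 + η)⁻¹ • p = t⁻¹ • (t • ((1 + η)⁻¹ • p)) := by
        rw [smul_smul t⁻¹, inv_mul_cancel₀ ht.ne', one_smul]
      rw [this, dist_smul₀, norm_inv, Real.norm_of_nonneg ht.le, inv_mul_le_iff₀ ht]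
      linarith
    have h6 : ‖(1 + η)⁻¹ • p‖ ≤ R := by
      rw [norm_smul, norm_inv, Real.norm_of_nonneg (by positivity), inv_mul_le_iff₀ (by positivity)]
      have : ‖p‖ ≤ R := by simpa using hKR hp
      nlinarith
    have h7 := dist_triangle p ((1 + η)⁻¹ • p) (t⁻¹ • z)
    have h8 : η * ‖(1 + η)⁻¹ • p‖ ≤ η * R := by gcongr
    linarith [min_le_left (ε / 2) (c * (ε / 2))]

/-! ### Category -/

lemma residual_exists_hausdorffEDist_le {d : ℕ} (hd : 0 < d) {A : Set ℝ≥0} {K : Set (Space d)}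
    (hK : K ∈ shapes d A) (hconv : Convex ℝ K) {ε : ℝ} (hε : 0 < ε) (T : ℝ) :
    ∀ᶠ ω in residual (Config d A), ∃ t : ℝ, T ≤ t ∧
      Metric.hausdorffEDist (t⁻¹ • ball ω t) K ≤ ENNReal.ofReal ε := by
  let G : Set (Config d A) := {ω | ∃ t : ℝ, T ≤ t ∧
      Metric.hausdorffEDist (t⁻¹ • ball ω t) K ≤ ENNReal.ofReal ε}
  suffices h : Dense (interior G) from
    mem_of_superset (residual_of_dense_open isOpen_interior h) interior_subset
  rw [dense_iff_inter_open]
  rintro O hO ⟨ω₀, hω₀⟩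
  obtain ⟨F, u, hu, hsub⟩ := isOpen_pi_iff.1 hO ω₀ hω₀
  obtain ⟨ω₁, hω₁, t, hT, hev⟩ := exists_config_hausdorffEDist_le hd hK hconv ω₀ F hε T
  refine ⟨ω₁, hsub fun e he => ?_, mem_interior_iff_mem_nhds.2 (hev.mono fun ω hω => ⟨t, hT, hω⟩)⟩
  rw [hω₁ e he]
  exact (hu e he).2

end FPP


theorem theorem1p3 (d : ℕ) (A : Set ℝ≥0) :
    ∀ᶠ ω in residual (FPP.Config d A),
      ∀ K ∈ FPP.shapes d A, Convex ℝ K →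
        ∃ t : ℕ → ℝ, Tendsto t atTop atTop ∧
          Tendsto (fun n => Metric.hausdorffEDist ((t n)⁻¹ • FPP.ball ω (t n)) K) atTop (𝓝 0) := by
  rcases Nat.eq_zero_or_pos d with rfl | hd
  · -- In dimension `0` both the ball and the shape are the whole one-point space.
    refine Eventually.of_forall fun ω K hK _ => ⟨fun n => n, tendsto_natCast_atTop_atTop, ?_⟩
    have hball (t : ℝ) : t⁻¹ • FPP.ball ω t = K := by
      obtain ⟨x, hx⟩ := hK.1.nonempty
      have hK' : K = Set.univ := Set.eq_univ_of_forall fun y => Subsingleton.elim x y ▸ hx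
      have h0 : (0 : FPP.Space 0) ∈ FPP.ball ω t := by
        change FPP.passageTime ω 0 0 ≤ _
        unfold FPP.passageTime
        exact (iInf_le _ SimpleGraph.Walk.nil).trans (by simp [FPP.pathTime])
      rw [hK']
      exact Set.eq_univ_of_forall fun y => Subsingleton.elim _ y ▸ Set.smul_mem_smul_set h0
    simp [hball]
  let P : Set (TopologicalSpace.NonemptyCompacts (FPP.Space d)) :=
    {K | (K : Set (FPP.Space d)) ∈ FPP.shapes d A ∧ Convex ℝ (K : Set (FPP.Space d))}
  obtain ⟨D, hD, hDdense⟩ := TopologicalSpace.exists_countable_dense P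
  have hres : ∀ᶠ ω in residual (FPP.Config d A), ∀ K ∈ D, ∀ n : ℕ, ∃ t : ℝ, (n : ℝ) ≤ t ∧
      Metric.hausdorffEDist (t⁻¹ • FPP.ball ω t) (K.1 : Set (FPP.Space d)) ≤
        ENNReal.ofReal (1 / (n + 1)) :=
    (eventually_countable_ball hD).2 fun K _ => eventually_countable_forall.2 fun n =>
      FPP.residual_exists_hausdorffEDist_le hd K.2.1 K.2.2 (by positivity) n
  filter_upwards [hres] with ω hω K hK hconv
  let K' : P := ⟨⟨⟨K, hK.2.1⟩, hK.1.nonempty⟩, hK, hconv⟩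
  have happrox (n : ℕ) : ∃ t : ℝ, (n : ℝ) ≤ t ∧ Metric.hausdorffEDist (t⁻¹ • FPP.ball ω t) K ≤
      ENNReal.ofReal (1 / (n + 1)) + ENNReal.ofReal (1 / (n + 1)) := by
    obtain ⟨L, hL, hLD⟩ := EMetric.mem_closure_iff.1 (hDdense K')
      (ENNReal.ofReal (1 / (n + 1))) (ENNReal.ofReal_pos.2 (by positivity))
    obtain ⟨t, ht, h⟩ := hω L hL n
    refine ⟨t, ht, Metric.hausdorffEDist_triangle.trans (add_le_add h ?_)⟩
    rw [edist_comm] at hLD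
    exact hLD.le
  choose t ht htK using happrox
  refine ⟨t, tendsto_atTop_mono ht tendsto_natCast_atTop_atTop, ?_⟩
  have hlim : Tendsto (fun n : ℕ => ENNReal.ofReal (1 / ((n : ℝ) + 1)) +
      ENNReal.ofReal (1 / (n + 1))) atTop (𝓝 0) := by
    have h := ENNReal.tendsto_ofReal (tendsto_one_div_add_atTop_nhds_zero_nat (𝕜 := ℝ))
    simpa using h.add h
  exact tendsto_of_tendsto_of_tendsto_of_le_of_le tendsto_const_nhds hlim (fun _ => zero_le) htK
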